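/- **One-sector trade model with country-specific labor shares: uniqueness and convergence.** Let there be $J$ countries and parameters $\sigma>1$, $\theta>\sigma-1$, productivities $A_i>0$, labor endowments $L_i>0$, labor cost shares $\gamma_i\in[0,1]$ (which may differ across countries) with $\gamma_i>0$ for at least one $i$, and iceberg trade costs $\tau_{ij}\in[1,\infty]$ with $\tau_{ii}<\infty$, where $\tau_{ij}^{-\theta}:=0$ if $\tau_{ij}=\infty$. Assume that the trade network, i.e. the directed graph on the countries with an edge $i\to j$ whenever $\tau_{ij}<\infty$, is strongly connected. Put $g=\Gamma\big(\tfrac{\theta+1-\sigma}{\theta}\big)$. An *equilibrium* consists of wages $w_i$, unit costs $c_i$, price indices $P_i>0$, revenues $R_i>0$ and expenditures $E_i$ with $$c_i=w_i^{\gamma_i}P_i^{1-\gamma_i},\quad P_i=g^{\frac1{1-\sigma}}\Big(\sum_j A_j(c_j\tau_{ji})^{-\theta}\Big)^{-1/\theta},\quad R_i=\sum_j\frac{A_i(c_i\tau_{ij})^{-\theta}}{\sum_l A_l(c_l\tau_{lj})^{-\theta}}E_j,$$ $$w_i=\gamma_iR_i/L_i,\qquad E_i=w_iL_i+(1-\gamma_i)R_i$$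 for all $i$ (with $0^0=1$). Its multilateral resistance terms are $\Omega_i=R_ic_i^{\theta}$ and $\mathbb P_i=P_i^{-\theta}$. On $\mathbb R^{2J}_{++}$, the set of vectors $x=(\Omega_1,\dots,\Omega_J,\mathbb P_1,\dots,\mathbb P_J)$ with positive entries, define $F$ by $$F(x)_{\Omega_i}=\sum_{j}g^{-\frac{\theta}{1-\sigma}}A_i\tau_{ij}^{-\theta}\Big(\frac{\gamma_j}{L_j}\Big)^{-\frac{\theta\gamma_j}{1+\theta\gamma_j}}\Omega_j^{\frac1{1+\theta\gamma_j}}\,\mathbb P_j^{\frac{1-\gamma_j}{1+\theta\gamma_j}-1},$$ $$F(x)_{\mathbb P_i}=\sum_{j}g^{-\frac{\theta}{1-\sigma}}A_j\tau_{ji}^{-\theta}\Big(\frac{\gamma_j}{L_j}\Big)^{-\frac{\theta\gamma_j}{1+\theta\gamma_j}}\Omega_j^{\frac1{1+\theta\gamma_j}-1}\,\mathbb P_j^{\frac{1-\gamma_j}{1+\theta\gamma_j}}.$$ For $k\neq0$ let $u=u(k)\in\mathbb R^{2J}$ be given by $u_{\mathbb P_i}=k$ and $u_{\Omega_i}=-\frac{1+\theta}{\theta}k$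 for all $i$, and write $c^ux=(c^{u_j}x_j)_j$. Then: 1. A vector $x\in\mathbb R^{2J}_{++}$ solves $x=F(x)$ if and only if it is the vector of multilateral resistance terms of an equilibrium. 2. $F$ is a continuously differentiable map of $\mathbb R^{2J}_{++}$ into itself such that, for every $x\in\mathbb R^{2J}_{++}$, the entrywise modulus $|DF(x)|$ of the Jacobian matrix is irreducible and some diagonal entry of $DF(x)$ is non-zero. For every $k\ne0$ the vector $u(k)$ is non-zero, $F(c^ux)=c^uF(x)$ for all $x\in\mathbb R^{2J}_{++}$ and $c>0$, and the monotonicity behavior of $F$ is consistent with $u$: the set of indices is a disjoint union $\zeta_+\cup\zeta_-$ with $u_j\ge0$ on $\zeta_+$ and $u_j\le0$ on $\zeta_-$, such that for all $x$ one has $\partial F_j/\partial x_l(x)\ge0$ if $j,l$ lie in the same class and $\partial F_j/\partial x_l(x)\le0$ otherwise. 3. If $x^*\in\mathbb R^{2J}_{++}$ solves $x^*=F(x^*)$, then for each $k\neq 0$ the solutions of $x=F(x)$ in $\mathbb R^{2J}_{++}$ are precisely the vectors $c^{u(k)}x^*$ with $c>0$; every solution $p$ is Lyapunov stable (for every $\varepsilon>0$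 there is $\delta>0$ such that $\|F^n(x)-F^n(p)\|<\varepsilon$ for all $n\ge0$ and all $x\in\mathbb R^{2J}_{++}$ with $\|x-p\|<\delta$); and for every $x\in\mathbb R^{2J}_{++}$ the iterates $F^n(x)$ converge to a solution in $\mathbb R^{2J}_{++}$ as $n\to\infty$. -/

import Mathlib

noncomputable section

/-! ### Self-maps of the open positive orthant -/

/-- The open positive orthant. -/
def posOrthant (ι : Type) : Set (ι → ℝ) := {x | ∀ j, 0 < x j}

/-- The componentwise scaling `c ^ u • x = (c ^ u_j * x_j)_j`. -/
def scaleBy {ι : Type} (c : ℝ) (u x : ι → ℝ) : ι → ℝ := fun j => c ^ u j * x j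

/-- The Jacobian matrix: the entry at `(j, k)` is the partial derivative of `F_j` with respect to
`x_k` at `x`. -/
def jacobian {ι : Type} [Fintype ι] [DecidableEq ι] (F : (ι → ℝ) → (ι → ℝ)) (x : ι → ℝ) :
    Matrix ι ι ℝ :=
  Matrix.of fun j k => fderiv ℝ F x (Pi.single k 1) j

/-- `F` connects all variables: the entrywise modulus of the Jacobian matrix is irreducible at
every point of the orthant. -/
def ConnectsAllVariables {ι : Type} [Fintype ι] [DecidableEq ι]
    (F : (ι → ℝ) → (ι → ℝ)) : Prop :=
  ∀ x ∈ posOrthant ι, ((jacobian F x).map fun a => |a|).IsIrreducible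

/-- `F` exhibits self-interaction. -/
def ExhibitsSelfInteraction {ι : Type} [Fintype ι] [DecidableEq ι]
    (F : (ι → ℝ) → (ι → ℝ)) : Prop :=
  ∀ x ∈ posOrthant ι, ∃ j, jacobian F x j j ≠ 0

/-- `F` scales with exponent `u`. -/
def ScalesWithExponent {ι : Type} (F : (ι → ℝ) → (ι → ℝ)) (u : ι → ℝ) : Prop :=
  ∀ x ∈ posOrthant ι, ∀ c : ℝ, 0 < c → F (scaleBy c u x) = scaleBy c u (F x)

/-- The monotonicity behavior of `F` is consistent with `u`; the two classes of the partition are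
`ζ` and its complement. -/
def MonotonicityConsistent {ι : Type} [Fintype ι] [DecidableEq ι]
    (F : (ι → ℝ) → (ι → ℝ)) (u : ι → ℝ) : Prop :=
  ∃ ζ : Set ι, (∀ j ∈ ζ, 0 ≤ u j) ∧ (∀ j ∉ ζ, u j ≤ 0) ∧
    ∀ x ∈ posOrthant ι, ∀ j k,
      ((j ∈ ζ ↔ k ∈ ζ) → 0 ≤ jacobian F x j k) ∧
      (¬ (j ∈ ζ ↔ k ∈ ζ) → jacobian F x j k ≤ 0)

/-- Lyapunov stability of the point `p` under iteration of `F` on the orthant. -/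
def LyapunovStable {ι : Type} [Fintype ι] (F : (ι → ℝ) → (ι → ℝ)) (p : ι → ℝ) : Prop :=
  ∀ ε > 0, ∃ δ > 0, ∀ x ∈ posOrthant ι, dist x p < δ → ∀ n : ℕ, dist (F^[n] x) (F^[n] p) < ε

/-! ### The one-sector trade model with country-specific labor shares -/

/-- Parameters of the model with `J` countries. -/
structure Economy (J : ℕ) where
  /-- spread of the productivity distributions -/
  θ : ℝ
  /-- elasticity of substitution between varieties -/
  σ : ℝ
  /-- productivity levels -/
  A : Fin J → ℝ
  /-- labor endowments -/
  L : Fin J → ℝ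
  /-- labor cost shares -/
  γ : Fin J → ℝ
  /-- iceberg trade costs: `τ i j` units are shipped from `i` for one unit to arrive in `j`;
  the value `⊤` means that `i` does not sell to `j` -/
  τ : Fin J → Fin J → ENNReal
  one_lt_σ : 1 < σ
  σ_sub_one_lt_θ : σ - 1 < θ
  A_pos : ∀ i, 0 < A i
  L_pos : ∀ i, 0 < L i
  γ_nonneg : ∀ i, 0 ≤ γ i
  γ_le_one : ∀ i, γ i ≤ 1
  one_le_τ : ∀ i j, 1 ≤ τ i j
  τ_self_ne_top : ∀ i, τ i i ≠ ⊤

namespace Economy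

variable {J : ℕ}

/-- The trade network is strongly connected: from every country one can reach every other country
along pairs with finite trade costs. -/
def StronglyConnected (M : Economy J) : Prop :=
  ∀ i j, Relation.ReflTransGen (fun a b => M.τ a b ≠ ⊤) i j

/-- `τ_ij ^ (-θ)`, which is `0` if `τ_ij = ∞`. -/
def tradeFactor (M : Economy J) (i j : Fin J) : ℝ := (M.τ i j ^ (-M.θ)).toReal

/-- `Γ((θ + 1 - σ) / θ)`. -/
def gammaConst (M : Economy J) : ℝ := Real.Gamma ((M.θ + 1 - M.σ) / M.θ)

/-- General equilibrium of the model with wages `w`, unit costs `c`, price indices `P`,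
revenues `R` and expenditures `E`. -/
structure IsEquilibrium (M : Economy J) (w c P R E : Fin J → ℝ) : Prop where
  P_pos : ∀ i, 0 < P i
  R_pos : ∀ i, 0 < R i
  unit_cost : ∀ i, c i = w i ^ M.γ i * P i ^ (1 - M.γ i)
  price_index : ∀ i, P i = M.gammaConst ^ (1 / (1 - M.σ)) *
    (∑ j, M.A j * (c j ^ (-M.θ) * M.tradeFactor j i)) ^ (-(1 / M.θ))
  goods_market : ∀ i, R i = ∑ j,
    (M.A i * (c i ^ (-M.θ) * M.tradeFactor i j) /
      ∑ l, M.A l * (c l ^ (-M.θ) * M.tradeFactor l j)) * E j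
  labor_market : ∀ i, w i = M.γ i * R i / M.L i
  balanced_trade : ∀ i, E i = w i * M.L i + (1 - M.γ i) * R i

/-- The stacked vector of the multilateral resistance terms: `Sum.inl i` is the index of
`Ω_i = R_i c_i ^ θ`, and `Sum.inr i` is the index of `ℙ_i = P_i ^ (-θ)`. -/
def resistance (M : Economy J) (c P R : Fin J → ℝ) : Fin J ⊕ Fin J → ℝ :=
  Sum.elim (fun i => R i * c i ^ M.θ) (fun i => P i ^ (-M.θ))

/-- The right-hand side of the equilibrium system in the variables `Ω_i` (index `Sum.inl i`) and
`ℙ_i` (index `Sum.inr i`). -/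
def rhs (M : Economy J) (x : Fin J ⊕ Fin J → ℝ) : Fin J ⊕ Fin J → ℝ :=
  Sum.elim
    (fun i => ∑ j, M.gammaConst ^ (-(M.θ / (1 - M.σ))) * M.A i * M.tradeFactor i j *
      (M.γ j / M.L j) ^ (-(M.θ * M.γ j / (1 + M.θ * M.γ j))) *
      x (Sum.inl j) ^ (1 / (1 + M.θ * M.γ j)) *
      x (Sum.inr j) ^ ((1 - M.γ j) / (1 + M.θ * M.γ j) - 1))
    (fun i => ∑ j, M.gammaConst ^ (-(M.θ / (1 - M.σ))) * M.A j * M.tradeFactor j i *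
      (M.γ j / M.L j) ^ (-(M.θ * M.γ j / (1 + M.θ * M.γ j))) *
      x (Sum.inl j) ^ (1 / (1 + M.θ * M.γ j) - 1) *
      x (Sum.inr j) ^ ((1 - M.γ j) / (1 + M.θ * M.γ j)))

/-- The scaling exponents: `u_ℙ = k` and `u_Ω = -((1 + θ) / θ) k` for all countries. -/
def exponent (M : Economy J) (k : ℝ) : Fin J ⊕ Fin J → ℝ :=
  Sum.elim (fun _ => -((1 + M.θ) / M.θ) * k) (fun _ => k)

end Economy

end

/-! Each component of the system is a sum of monomials. Put `x_j = exp (u_j * y_j)` with `u = u(1)`: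
the monomials of row `r` become `exp (u_r * m)`, where `m` is a weighted average of the
`y`-variables of one country (`powerMap_expChart`). In these coordinates the map is topical: sign
changes from `u_r < 0` cancel, so it is monotone, and the weights sum to 1, so it commutes with
adding constants (`isTopical_logMap`).

Topical maps are sup-norm nonexpansive, which gives stability. Given a fixed point `p`, the quantity
`max (y - p)` decreases along orbits. At a limit point it is constant along the orbit, and strong
connectivity with a loop then forces the limit point to be a translate of `p`
(`IsTopical.exists_tendsto_iterate`). Translates correspond to the scalings `c ^ u`, and uniqueness
follows because the orbit of a fixed point is constant.

For the economic model it remains to check the dependency graph (`transGen_dependsOnVar`) and to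
solve `Ω = R c ^ θ` for the revenue (`revenue_eq_iff`), which identifies equilibria with solutions.
-/

/-! ### Relations and irreducible matrices -/

/-- Along a strongly connected relation with a loop, a nonempty set that spreads backwards along
the relation at every step eventually covers everything. -/
theorem eventually_forall_mem_of_spread {ι : Type*} [Finite ι] {E : ι → ι → Prop}
    (hE : ∀ j k, Relation.ReflTransGen E j k) (hloop : ∃ j, E j j) (S : ℕ → Set ι)
    (hS : (S 0).Nonempty) (hstep : ∀ n j k, E j k → k ∈ S n → j ∈ S (n + 1)) :
    ∀ᶠ n in Filter.atTop, ∀ j, j ∈ S n := by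
  obtain ⟨l, hl⟩ := hloop
  obtain ⟨k₀, hk₀⟩ := hS
  have hreach : ∀ j, ∃ n, j ∈ S n := by
    intro j
    induction hE j k₀ using Relation.ReflTransGen.head_induction_on with
    | refl => exact ⟨0, hk₀⟩
    | head h _ ih =>
      obtain ⟨n, hn⟩ := ih
      exact ⟨n + 1, hstep n _ _ h hn⟩
  -- The loop keeps `l` in the set once it has entered; without a loop, membership could be
  -- periodic.
  have hlS : ∀ᶠ n in Filter.atTop, l ∈ S n := by
    obtain ⟨m, hm⟩ := hreach l
    rw [Filter.eventually_atTop]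
    refine ⟨m, fun n hn => ?_⟩
    induction n, hn using Nat.le_induction with
    | base => exact hm
    | succ n _ ih => exact hstep n _ _ hl ih
  rw [Filter.eventually_all]
  intro j
  induction hE j l using Relation.ReflTransGen.head_induction_on with
  | refl => exact hlS
  | head h _ ih =>
    rw [Filter.eventually_atTop] at ih ⊢
    obtain ⟨m, hm⟩ := ih
    refine ⟨m + 1, fun n hn => ?_⟩
    obtain ⟨n, rfl⟩ : ∃ n', n = n' + 1 := ⟨n - 1, by omega⟩
    exact hstep n _ _ h (hm n (by omega))

/-- A nonnegative matrix is irreducible if the relation given by its positive entries connects any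
two indices. -/
theorem Matrix.isIrreducible_of_transGen {n : Type*} {A : Matrix n n ℝ}
    (hA : ∀ i j, 0 ≤ A i j) (h : ∀ i j, Relation.TransGen (fun i j => 0 < A i j) i j) :
    A.IsIrreducible := by
  refine ⟨hA, fun i j => ?_⟩
  let : Quiver n := A.toQuiver
  induction h i j with
  | single h => exact ⟨(Quiver.Path.nil).cons (PLift.up h), by simp⟩
  | tail _ h ih =>
    obtain ⟨p, hp⟩ := ih
    exact ⟨p.cons (PLift.up h), by simp⟩

/-! ### Topical maps -/

/-- A monotone self-map of `ℝ^ι` that commutes with the addition of constants. -/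
structure IsTopical {ι : Type*} (G : (ι → ℝ) → (ι → ℝ)) : Prop where
  monotone : Monotone G
  add_const : ∀ (y : ι → ℝ) (s : ℝ), G (fun j => y j + s) = fun j => G y j + s

namespace IsTopical

variable {ι : Type*} {G : (ι → ℝ) → (ι → ℝ)}

theorem le_add_const (hG : IsTopical G) {y z : ι → ℝ} {s : ℝ} (h : ∀ j, y j ≤ z j + s) (j : ι) :
    G y j ≤ G z j + s := by
  have h1 := hG.monotone (show y ≤ fun j => z j + s from h) j
  rwa [hG.add_const] at h1

theorem iterate (hG : IsTopical G) (n : ℕ) : IsTopical G^[n] := by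
  refine ⟨hG.monotone.iterate n, ?_⟩
  induction n with
  | zero => intro y s; rfl
  | succ n ih =>
    intro y s
    rw [Function.iterate_succ_apply, hG.add_const, ih]
    rfl

variable [Fintype ι]

/-- With `d = dist y z` one has `y ≤ z + d` and `z ≤ y + d`, and a topical map preserves both
inequalities. -/
theorem dist_le (hG : IsTopical G) (y z : ι → ℝ) : dist (G y) (G z) ≤ dist y z := by
  rw [dist_pi_le_iff dist_nonneg]
  intro j
  have h : ∀ k, |y k - z k| ≤ dist y z := fun k => by
    rw [← Real.dist_eq]; exact dist_le_pi_dist y z k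
  rw [Real.dist_eq, abs_sub_le_iff]
  constructor
  · have := hG.le_add_const (y := y) (z := z) (s := dist y z)
      (fun k => by linarith [(abs_le.1 (h k)).2]) j
    linarith
  · have := hG.le_add_const (y := z) (z := y) (s := dist y z)
      (fun k => by linarith [(abs_le.1 (h k)).1]) j
    linarith

theorem continuous (hG : IsTopical G) : Continuous G :=
  (LipschitzWith.of_dist_le_mul (K := 1) fun y z => by simpa using hG.dist_le y z).continuous

/-- The iterates of a topical map with a fixed point converge, to a translate of the fixed point,
if the map is strictly monotone along a strongly connected relation with a loop. -/
theorem exists_tendsto_iterate [Nonempty ι] (hG : IsTopical G) {p : ι → ℝ} (hp : G p = p)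
    {E : ι → ι → Prop} (hE : ∀ j k, Relation.ReflTransGen E j k) (hloop : ∃ j, E j j)
    (hstrict : ∀ y z : ι → ℝ, y ≤ z → ∀ j k, E j k → y k < z k → G y j < G z j) (y : ι → ℝ) :
    ∃ s : ℝ, Filter.Tendsto (fun n : ℕ => G^[n] y) Filter.atTop (nhds fun j => p j + s) := by
  -- `top z` is the least `s` with `z ≤ p + s`; it serves as a Lyapunov function.
  let top : (ι → ℝ) → ℝ := fun z =>
    Finset.univ.sup' Finset.univ_nonempty fun j => z j - p j
  have htop_cont : Continuous top :=
    Continuous.finset_sup'_apply _ fun j _ => (continuous_apply j).sub continuous_const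
  have hle_top : ∀ z j, z j - p j ≤ top z := fun z j =>
    Finset.le_sup' (fun j => z j - p j) (Finset.mem_univ j)
  have hpn : ∀ n, G^[n] p = p := fun n => Function.iterate_fixed hp n
  have hfix : ∀ s : ℝ, ∀ n, (G^[n] fun j => p j + s) = fun j => p j + s := fun s n => by
    rw [(hG.iterate n).add_const, hpn]
  have hanti : Antitone fun n => top (G^[n] y) := by
    refine antitone_nat_of_succ_le fun n => Finset.sup'_le _ _ fun j _ => ?_
    have := hG.le_add_const (y := G^[n] y) (z := p) (s := top (G^[n] y))
      (fun k => by linarith [hle_top (G^[n] y) k]) j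
    rw [hp] at this
    rw [Function.iterate_succ_apply']
    linarith
  have hball : ∀ n, G^[n] y ∈ Metric.closedBall p (dist y p) := fun n => by
    have := (hG.iterate n).dist_le y p
    rwa [hpn] at this
  obtain ⟨q, -, φ, hφ, hq⟩ := (isCompact_closedBall p (dist y p)).tendsto_subseq hball
  have hlim_sub : Filter.Tendsto (fun n => top (G^[φ n] y)) Filter.atTop (nhds (top q)) :=
    (htop_cont.tendsto q).comp hq
  have hlim : Filter.Tendsto (fun n => top (G^[n] y)) Filter.atTop (nhds (top q)) :=
    (tendsto_iff_tendsto_subseq_of_antitone hanti hφ.tendsto_atTop).2 hlim_sub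
  -- Each iterate of `q` is again a limit point of the orbit, and the monotone values of `top` have
  -- only one limit.
  have htop_iter : ∀ n, top (G^[n] q) = top q := by
    intro n
    have h1 : Filter.Tendsto (fun m => top (G^[n + φ m] y)) Filter.atTop
        (nhds (top (G^[n] q))) := by
      simp_rw [Function.iterate_add_apply]
      exact ((htop_cont.comp (hG.iterate n).continuous).tendsto q).comp hq
    exact tendsto_nhds_unique h1 (hlim.comp
      (Filter.tendsto_atTop_mono (fun m => Nat.le_add_left _ _) hφ.tendsto_atTop))
  have hq_eq : q = fun j => p j + top q := by
    by_contra hne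
    obtain ⟨k, hk⟩ : ∃ k, q k < p k + top q := by
      by_contra! hcon
      exact hne (funext fun j => le_antisymm (by linarith [hle_top q j]) (hcon j))
    have hle : ∀ n, G^[n] q ≤ fun j => p j + top q := fun n j => by
      have := hle_top (G^[n] q) j
      rw [htop_iter] at this
      change _ ≤ p j + top q
      linarith
    -- Strict inequality at one coordinate spreads to all of them, so `top` would drop strictly
    -- along the orbit of `q`.
    have hev := eventually_forall_mem_of_spread hE hloop
      (fun n => {j | G^[n] q j < p j + top q}) ⟨k, hk⟩ (fun n i j hij hj => by
        have := hstrict _ _ (hle n) i j hij hj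
        rw [show G (fun j => p j + top q) = fun j => p j + top q from hfix _ 1] at this
        change G^[n + 1] q i < _
        rwa [Function.iterate_succ_apply'])
    obtain ⟨n, hn⟩ := hev.exists
    have : top (G^[n] q) < top q := (Finset.sup'_lt_iff _).2 fun j _ => by
      have h : G^[n] q j < p j + top q := hn j
      linarith
    exact this.ne (htop_iter n)
  refine ⟨top q, ?_⟩
  rw [← hq_eq]
  -- The limit point is fixed, so by nonexpansiveness an orbit once close to it stays close: the
  -- whole sequence converges.
  have hqn : ∀ n, G^[n] q = q := fun n => by rw [hq_eq]; exact hfix _ n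
  rw [Metric.tendsto_atTop] at hq ⊢
  intro ε hε
  obtain ⟨m, hm⟩ := hq ε hε
  refine ⟨φ m, fun n hn => ?_⟩
  obtain ⟨l, rfl⟩ := Nat.exists_eq_add_of_le' hn
  rw [Function.iterate_add_apply]
  calc dist (G^[l] (G^[φ m] y)) q = dist (G^[l] (G^[φ m] y)) (G^[l] q) := by rw [hqn]
    _ ≤ dist (G^[φ m] y) q := (hG.iterate l).dist_le _ _
    _ < ε := hm m le_rfl

end IsTopical

noncomputable section

/-! ### Sums of monomials that are geometric averages after a change of variables -/

/-- The map whose component `r` is the sum of `C r j * x_{inl j} ^ a * x_{inr j} ^ b` over `j`, with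
the exponents `a = u_r W_{r, inl j} / u_{inl j}` and `b = u_r W_{r, inr j} / u_{inr j}`. -/
def powerMap {K : Type} [Fintype K] (C : K ⊕ K → K → ℝ) (u : K ⊕ K → ℝ)
    (W : K ⊕ K → K ⊕ K → ℝ) (x : K ⊕ K → ℝ) (r : K ⊕ K) : ℝ :=
  ∑ j, C r j * x (Sum.inl j) ^ (u r * W r (Sum.inl j) / u (Sum.inl j)) *
    x (Sum.inr j) ^ (u r * W r (Sum.inr j) / u (Sum.inr j))

/-- The data of a `powerMap` with nonnegative coefficients, at least one of them positive in every
row, nonzero scaling exponents, and weights that form probability vectors. -/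
structure IsAveraging {K : Type} (C : K ⊕ K → K → ℝ) (u : K ⊕ K → ℝ)
    (W : K ⊕ K → K ⊕ K → ℝ) : Prop where
  coeff_nonneg : ∀ r j, 0 ≤ C r j
  exists_coeff_pos : ∀ r, ∃ j, 0 < C r j
  exponent_ne_zero : ∀ r, u r ≠ 0
  weight_nonneg : ∀ r k, 0 ≤ W r k
  weight_add : ∀ r j, W r (Sum.inl j) + W r (Sum.inr j) = 1

/-- Component `r` of the power map depends on the variable `k`. -/
def DependsOnVar {K : Type} (C : K ⊕ K → K → ℝ) (W : K ⊕ K → K ⊕ K → ℝ) (r k : K ⊕ K) : Prop :=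
  0 < C r (Sum.elim id id k) ∧ 0 < W r k

/-- The chart `y ↦ (exp (u_j y_j))_j` of the positive orthant. -/
def expChart {ι : Type} (u y : ι → ℝ) : ι → ℝ := fun j => Real.exp (u j * y j)

/-- The inverse of `expChart`. -/
def logChart {ι : Type} (u x : ι → ℝ) : ι → ℝ := fun j => Real.log (x j) / u j

/-! ### Exponential and logarithmic coordinates on the orthant -/

section Charts

variable {ι : Type} {u : ι → ℝ}

theorem expChart_mem (u y : ι → ℝ) : expChart u y ∈ posOrthant ι := fun _ => Real.exp_pos _

theorem logChart_expChart (hu : ∀ j, u j ≠ 0) (y : ι → ℝ) : logChart u (expChart u y) = y := by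
  funext j
  simp [logChart, expChart, mul_div_cancel_left₀ _ (hu j)]

theorem expChart_logChart (hu : ∀ j, u j ≠ 0) {x : ι → ℝ} (hx : x ∈ posOrthant ι) :
    expChart u (logChart u x) = x := by
  funext j
  simp only [logChart, expChart]
  rw [mul_div_cancel₀ _ (hu j), Real.exp_log (hx j)]

theorem expChart_add_const (y : ι → ℝ) (s : ℝ) :
    expChart u (fun j => y j + s) = scaleBy (Real.exp s) u (expChart u y) := by
  funext j
  simp only [scaleBy, expChart]
  rw [← Real.exp_mul, ← Real.exp_add]
  ring_nf

theorem continuous_expChart (u : ι → ℝ) : Continuous (expChart u) :=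
  continuous_pi fun j => by unfold expChart; fun_prop

theorem continuousAt_logChart {x : ι → ℝ} (hx : x ∈ posOrthant ι) :
    ContinuousAt (logChart u) x :=
  continuousAt_pi.2 fun j =>
    (ContinuousAt.log (f := fun y : ι → ℝ => y j) (continuous_apply j).continuousAt
      (hx j).ne').div_const _

theorem isOpen_posOrthant (ι : Type) [Finite ι] : IsOpen (posOrthant ι) := by
  have : posOrthant ι = ⋂ j, {x | 0 < x j} := by ext; simp [posOrthant]
  rw [this]
  exact isOpen_iInter_of_finite fun j => isOpen_lt continuous_const (continuous_apply j)

theorem scaleBy_mem {c : ℝ} (hc : 0 < c) (u : ι → ℝ) {x : ι → ℝ} (hx : x ∈ posOrthant ι) :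
    scaleBy c u x ∈ posOrthant ι := fun j => mul_pos (Real.rpow_pos_of_pos hc _) (hx j)

/-- Reduces the exponent vector `u(k)` to `u(1)`. -/
theorem scaleBy_const_mul {c : ℝ} (hc : 0 < c) (k : ℝ) (u x : ι → ℝ) :
    scaleBy c (fun j => k * u j) x = scaleBy (c ^ k) u x := by
  funext j
  simp only [scaleBy]
  rw [Real.rpow_mul hc.le]

end Charts

/-! ### Averaging power maps: scaling, Jacobian and dynamics -/

namespace IsAveraging

variable {K : Type} {C : K ⊕ K → K → ℝ} {u : K ⊕ K → ℝ} {W : K ⊕ K → K ⊕ K → ℝ}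

theorem average_mono (h : IsAveraging C u W) {y z : K ⊕ K → ℝ} (hyz : y ≤ z) (r : K ⊕ K) (j : K) :
    W r (Sum.inl j) * y (Sum.inl j) + W r (Sum.inr j) * y (Sum.inr j) ≤
      W r (Sum.inl j) * z (Sum.inl j) + W r (Sum.inr j) * z (Sum.inr j) :=
  add_le_add (mul_le_mul_of_nonneg_left (hyz _) (h.weight_nonneg _ _))
    (mul_le_mul_of_nonneg_left (hyz _) (h.weight_nonneg _ _))

/-- `Sum.elim id id k` is the index of the only summand that contains the variable `k`. -/
theorem average_lt (h : IsAveraging C u W) {y z : K ⊕ K → ℝ} (hyz : y ≤ z) {r k : K ⊕ K}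
    (hW : 0 < W r k) (hk : y k < z k) :
    W r (Sum.inl (Sum.elim id id k)) * y (Sum.inl (Sum.elim id id k)) +
        W r (Sum.inr (Sum.elim id id k)) * y (Sum.inr (Sum.elim id id k)) <
      W r (Sum.inl (Sum.elim id id k)) * z (Sum.inl (Sum.elim id id k)) +
        W r (Sum.inr (Sum.elim id id k)) * z (Sum.inr (Sum.elim id id k)) := by
  rcases k with m | m
  · exact add_lt_add_of_lt_of_le (mul_lt_mul_of_pos_left hk hW)
      (mul_le_mul_of_nonneg_left (hyz _) (h.weight_nonneg _ _))
  · exact add_lt_add_of_le_of_lt (mul_le_mul_of_nonneg_left (hyz _) (h.weight_nonneg _ _))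
      (mul_lt_mul_of_pos_left hk hW)

variable [Fintype K]

theorem mapsTo (h : IsAveraging C u W) :
    Set.MapsTo (powerMap C u W) (posOrthant (K ⊕ K)) (posOrthant (K ⊕ K)) := by
  intro x hx r
  obtain ⟨j, hj⟩ := h.exists_coeff_pos r
  refine Finset.sum_pos' (fun l _ => ?_) ⟨j, Finset.mem_univ j, ?_⟩
  · exact mul_nonneg (mul_nonneg (h.coeff_nonneg r l) (Real.rpow_nonneg (hx _).le _))
      (Real.rpow_nonneg (hx _).le _)
  · exact mul_pos (mul_pos hj (Real.rpow_pos_of_pos (hx _) _)) (Real.rpow_pos_of_pos (hx _) _)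

theorem powerMap_expChart (h : IsAveraging C u W) (y : K ⊕ K → ℝ) (r : K ⊕ K) :
    powerMap C u W (expChart u y) r = ∑ j, C r j *
      Real.exp (u r * (W r (Sum.inl j) * y (Sum.inl j) + W r (Sum.inr j) * y (Sum.inr j))) := by
  refine Finset.sum_congr rfl fun j _ => ?_
  have h1 := h.exponent_ne_zero (Sum.inl j)
  have h2 := h.exponent_ne_zero (Sum.inr j)
  simp only [expChart]
  rw [← Real.exp_mul, ← Real.exp_mul, mul_assoc, ← Real.exp_add]
  congr 2
  field_simp

/-- Scaling by `c` is translation by `log c` in the chart, and averages with weights of sum 1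
commute with translations. -/
theorem scalesWithExponent (h : IsAveraging C u W) :
    ScalesWithExponent (powerMap C u W) u := by
  intro x hx c hc
  rw [← expChart_logChart h.exponent_ne_zero hx, ← Real.exp_log hc, ← expChart_add_const]
  funext r
  rw [h.powerMap_expChart]
  simp only [scaleBy]
  rw [h.powerMap_expChart, ← Real.exp_mul, Finset.mul_sum]
  refine Finset.sum_congr rfl fun j _ => ?_
  rw [mul_left_comm, ← Real.exp_add]
  congr 2
  linear_combination (u r * Real.log c) * h.weight_add r j

theorem contDiffOn (C : K ⊕ K → K → ℝ) (u : K ⊕ K → ℝ) (W : K ⊕ K → K ⊕ K → ℝ) :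
    ContDiffOn ℝ 1 (powerMap C u W) (posOrthant (K ⊕ K)) := by
  intro x hx
  refine ContDiffAt.contDiffWithinAt (contDiffAt_pi.2 fun r => ?_)
  refine ContDiffAt.sum fun j _ => ContDiffAt.mul (ContDiffAt.mul contDiffAt_const ?_) ?_
  · exact ContDiffAt.rpow_const_of_ne (contDiffAt_apply _ _ _ _) (hx _).ne'
  · exact ContDiffAt.rpow_const_of_ne (contDiffAt_apply _ _ _ _) (hx _).ne'

/-- Only one summand involves `x_k`, and differentiating it brings down the exponent `u_r W_{r,k} /
u_k`. The remaining factor `t` is a product of powers, so signs and zeros of the entry are explicit.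
-/
theorem jacobian_apply [DecidableEq K] (C : K ⊕ K → K → ℝ) (u : K ⊕ K → ℝ)
    (W : K ⊕ K → K ⊕ K → ℝ) {x : K ⊕ K → ℝ}
    (hx : x ∈ posOrthant (K ⊕ K)) (r k : K ⊕ K) :
    ∃ t > 0, jacobian (powerMap C u W) x r k =
      t * (C r (Sum.elim id id k) * W r k * (u r / u k)) := by
  have hdiff : DifferentiableAt ℝ (powerMap C u W) x :=
    ((contDiffOn C u W).differentiableOn one_ne_zero).differentiableAt
      ((isOpen_posOrthant _).mem_nhds hx)
  have hcoord : ∀ l : K ⊕ K, HasFDerivAt (fun y : K ⊕ K → ℝ => y l)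
      (ContinuousLinearMap.proj (R := ℝ) (φ := fun _ : K ⊕ K => ℝ) l) x :=
    fun l => (ContinuousLinearMap.proj (R := ℝ) (φ := fun _ : K ⊕ K => ℝ) l).hasFDerivAt
  have hsum := HasFDerivAt.fun_sum (u := (Finset.univ : Finset K)) fun j _ =>
    (((hcoord (Sum.inl j)).rpow_const (p := u r * W r (Sum.inl j) / u (Sum.inl j))
      (Or.inl (hx _).ne')).const_mul (C r j)).mul
    ((hcoord (Sum.inr j)).rpow_const (p := u r * W r (Sum.inr j) / u (Sum.inr j))
      (Or.inl (hx _).ne'))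
  have hval : jacobian (powerMap C u W) x r k = _ :=
    (congrArg (fun T => T (Pi.single k 1)) (((hasFDerivAt_pi'.1 hdiff.hasFDerivAt r).unique hsum)))
  rw [hval]
  rcases k with m | m
  · refine ⟨x (Sum.inl m) ^ (u r * W r (Sum.inl m) / u (Sum.inl m) - 1) *
      x (Sum.inr m) ^ (u r * W r (Sum.inr m) / u (Sum.inr m)),
      mul_pos (Real.rpow_pos_of_pos (hx _) _) (Real.rpow_pos_of_pos (hx _) _), ?_⟩
    simp [Pi.single_apply]
    ring
  · refine ⟨x (Sum.inl m) ^ (u r * W r (Sum.inl m) / u (Sum.inl m)) *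
      x (Sum.inr m) ^ (u r * W r (Sum.inr m) / u (Sum.inr m) - 1),
      mul_pos (Real.rpow_pos_of_pos (hx _) _) (Real.rpow_pos_of_pos (hx _) _), ?_⟩
    simp [Pi.single_apply]
    ring

theorem jacobian_ne_zero [DecidableEq K] (h : IsAveraging C u W) {x : K ⊕ K → ℝ}
    (hx : x ∈ posOrthant (K ⊕ K)) {r k : K ⊕ K} (hrk : DependsOnVar C W r k) :
    jacobian (powerMap C u W) x r k ≠ 0 := by
  obtain ⟨t, ht, heq⟩ := jacobian_apply C u W hx r k
  rw [heq]
  exact mul_ne_zero ht.ne' (mul_ne_zero (mul_pos hrk.1 hrk.2).ne'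
    (div_ne_zero (h.exponent_ne_zero r) (h.exponent_ne_zero k)))

theorem connectsAllVariables [DecidableEq K] (h : IsAveraging C u W)
    (hconn : ∀ r k, Relation.TransGen (DependsOnVar C W) r k) :
    ConnectsAllVariables (powerMap C u W) := by
  intro x hx
  refine Matrix.isIrreducible_of_transGen (fun r k => abs_nonneg _) fun r k => ?_
  exact Relation.TransGen.mono (fun a b hab => abs_pos.2 (h.jacobian_ne_zero hx hab)) _ _
    (hconn r k)

theorem exhibitsSelfInteraction [DecidableEq K] (h : IsAveraging C u W)
    (hloop : ∃ r, DependsOnVar C W r r) : ExhibitsSelfInteraction (powerMap C u W) := by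
  obtain ⟨r, hr⟩ := hloop
  exact fun x hx => ⟨r, h.jacobian_ne_zero hx hr⟩

/-- A Jacobian entry is zero or has the sign of `u_r / u_l`, in which a common factor `k` cancels;
the classes are therefore the sign classes of `k * u`. -/
theorem monotonicityConsistent [DecidableEq K] (h : IsAveraging C u W) {k : ℝ} (hk : k ≠ 0) :
    MonotonicityConsistent (powerMap C u W) fun j => k * u j := by
  refine ⟨{j | 0 ≤ k * u j}, fun j hj => hj, fun j hj => (not_le.1 hj).le, fun x hx r l => ?_⟩
  obtain ⟨t, ht, heq⟩ := jacobian_apply C u W hx r l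
  have hcw : 0 ≤ C r (Sum.elim id id l) * W r l :=
    mul_nonneg (h.coeff_nonneg _ _) (h.weight_nonneg _ _)
  have hquot : u r / u l = (k * u r) / (k * u l) := (mul_div_mul_left _ _ hk).symm
  rw [heq, hquot]
  simp only [Set.mem_ofPred_eq]
  constructor
  · intro hiff
    refine mul_nonneg ht.le (mul_nonneg hcw ?_)
    rcases le_or_gt 0 (k * u l) with hl | hl
    · exact div_nonneg (hiff.2 hl) hl
    · exact div_nonneg_of_nonpos (not_le.1 fun hr => hl.not_ge (hiff.1 hr)).le hl.le
  · intro hiff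
    refine mul_nonpos_of_nonneg_of_nonpos ht.le (mul_nonpos_of_nonneg_of_nonpos hcw ?_)
    rcases le_or_gt 0 (k * u l) with hl | hl
    · exact div_nonpos_of_nonpos_of_nonneg (not_le.1 fun hr => hiff ⟨fun _ => hl, fun _ => hr⟩).le hl
    · refine div_nonpos_of_nonneg_of_nonpos (not_lt.1 fun hr => hiff ?_) hl.le
      exact ⟨fun h' => absurd h' hr.not_ge, fun h' => absurd h' hl.not_ge⟩

/-! #### Dynamics in logarithmic coordinates -/

/-- The power map in the coordinates given by `expChart`. -/
def logMap (C : K ⊕ K → K → ℝ) (u : K ⊕ K → ℝ) (W : K ⊕ K → K ⊕ K → ℝ)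
    (y : K ⊕ K → ℝ) : K ⊕ K → ℝ :=
  logChart u (powerMap C u W (expChart u y))

theorem semiconj (h : IsAveraging C u W) :
    Function.Semiconj (expChart u) (logMap C u W) (powerMap C u W) := fun y =>
  expChart_logChart h.exponent_ne_zero (h.mapsTo (expChart_mem u y))

/-- If `u_r < 0`, both `exp (u_r * ·)` and the division by `u_r` reverse the order, and the
reversals cancel. -/
theorem logMap_monotone (h : IsAveraging C u W) : Monotone (logMap C u W) := by
  intro y z hyz r
  have hy := h.mapsTo (expChart_mem u y) r
  have hz := h.mapsTo (expChart_mem u z) r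
  simp only [logMap, logChart]
  rcases (h.exponent_ne_zero r).lt_or_gt with hu | hu
  · refine div_le_div_of_nonpos_of_le hu.le (Real.log_le_log hz ?_)
    rw [h.powerMap_expChart, h.powerMap_expChart]
    exact Finset.sum_le_sum fun j _ => mul_le_mul_of_nonneg_left (Real.exp_le_exp.2
      (mul_le_mul_of_nonpos_left (h.average_mono hyz r j) hu.le)) (h.coeff_nonneg r j)
  · refine div_le_div_of_nonneg_right (Real.log_le_log hy ?_) hu.le
    rw [h.powerMap_expChart, h.powerMap_expChart]
    exact Finset.sum_le_sum fun j _ => mul_le_mul_of_nonneg_left (Real.exp_le_exp.2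
      (mul_le_mul_of_nonneg_left (h.average_mono hyz r j) hu.le)) (h.coeff_nonneg r j)

theorem logMap_lt (h : IsAveraging C u W) {y z : K ⊕ K → ℝ} (hyz : y ≤ z) {r k : K ⊕ K}
    (hrk : DependsOnVar C W r k) (hk : y k < z k) : logMap C u W y r < logMap C u W z r := by
  have hy := h.mapsTo (expChart_mem u y) r
  have hz := h.mapsTo (expChart_mem u z) r
  have hlt := h.average_lt hyz hrk.2 hk
  simp only [logMap, logChart]
  rcases (h.exponent_ne_zero r).lt_or_gt with hu | hu
  · refine div_lt_div_of_neg_of_lt hu (Real.log_lt_log hz ?_)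
    rw [h.powerMap_expChart, h.powerMap_expChart]
    refine Finset.sum_lt_sum (fun j _ => ?_) ⟨_, Finset.mem_univ _, mul_lt_mul_of_pos_left
      (Real.exp_lt_exp.2 (mul_lt_mul_of_neg_left hlt hu)) hrk.1⟩
    exact mul_le_mul_of_nonneg_left (Real.exp_le_exp.2
      (mul_le_mul_of_nonpos_left (h.average_mono hyz r j) hu.le)) (h.coeff_nonneg r j)
  · refine div_lt_div_of_pos_right (Real.log_lt_log hy ?_) hu
    rw [h.powerMap_expChart, h.powerMap_expChart]
    refine Finset.sum_lt_sum (fun j _ => ?_) ⟨_, Finset.mem_univ _, mul_lt_mul_of_pos_left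
      (Real.exp_lt_exp.2 (mul_lt_mul_of_pos_left hlt hu)) hrk.1⟩
    exact mul_le_mul_of_nonneg_left (Real.exp_le_exp.2
      (mul_le_mul_of_nonneg_left (h.average_mono hyz r j) hu.le)) (h.coeff_nonneg r j)

theorem isTopical_logMap (h : IsAveraging C u W) : IsTopical (logMap C u W) := by
  refine ⟨h.logMap_monotone, fun y s => ?_⟩
  rw [← logChart_expChart h.exponent_ne_zero fun j => logMap C u W y j + s, expChart_add_const,
    h.semiconj, logMap, expChart_add_const,
    h.scalesWithExponent _ (expChart_mem u y) _ (Real.exp_pos s)]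

theorem logMap_logChart (h : IsAveraging C u W) {p : K ⊕ K → ℝ} (hp : p ∈ posOrthant (K ⊕ K))
    (hfix : powerMap C u W p = p) : logMap C u W (logChart u p) = logChart u p := by
  rw [logMap, expChart_logChart h.exponent_ne_zero hp, hfix]

/-- Nonexpansiveness holds in the chart; continuity of the two charts at the base point transfers it
to the orthant, uniformly in `n`. -/
theorem lyapunovStable (h : IsAveraging C u W) {p : K ⊕ K → ℝ} (hp : p ∈ posOrthant (K ⊕ K))
    (hfix : powerMap C u W p = p) : LyapunovStable (powerMap C u W) p := by
  intro ε hε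
  have hu := h.exponent_ne_zero
  obtain ⟨η, hη, hexp⟩ := Metric.continuousAt_iff.1
    ((continuous_expChart u).continuousAt (x := logChart u p)) ε hε
  obtain ⟨δ, hδ, hlog⟩ := Metric.continuousAt_iff.1 (continuousAt_logChart (u := u) hp) η hη
  refine ⟨δ, hδ, fun x hx hxp n => ?_⟩
  have hdist : dist ((logMap C u W)^[n] (logChart u x)) (logChart u p) < η := by
    have := (h.isTopical_logMap.iterate n).dist_le (logChart u x) (logChart u p)
    rw [Function.iterate_fixed (h.logMap_logChart hp hfix) n] at this
    exact this.trans_lt (hlog hxp)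
  have := hexp hdist
  rwa [(h.semiconj.iterate_right n) (logChart u x), expChart_logChart hu hx,
    expChart_logChart hu hp, ← Function.iterate_fixed hfix n] at this

theorem exists_tendsto_iterate (h : IsAveraging C u W)
    (hconn : ∀ r k, Relation.TransGen (DependsOnVar C W) r k)
    (hloop : ∃ r, DependsOnVar C W r r) {p : K ⊕ K → ℝ} (hp : p ∈ posOrthant (K ⊕ K))
    (hfix : powerMap C u W p = p) {x : K ⊕ K → ℝ} (hx : x ∈ posOrthant (K ⊕ K)) :
    ∃ c : ℝ, 0 < c ∧ Filter.Tendsto (fun n : ℕ => (powerMap C u W)^[n] x) Filter.atTop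
      (nhds (scaleBy c u p)) := by
  obtain ⟨r, hr⟩ := hloop
  have : Nonempty (K ⊕ K) := ⟨r⟩
  obtain ⟨s, hs⟩ := h.isTopical_logMap.exists_tendsto_iterate (h.logMap_logChart hp hfix)
    (fun j k => (hconn j k).to_reflTransGen) ⟨r, hr⟩
    (fun y z hyz j k hjk hk => h.logMap_lt hyz hjk hk) (logChart u x)
  refine ⟨Real.exp s, Real.exp_pos s, ?_⟩
  have hlim := ((continuous_expChart u).tendsto _).comp hs
  rw [expChart_add_const, expChart_logChart h.exponent_ne_zero hp] at hlim
  refine hlim.congr fun n => ?_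
  rw [Function.comp_apply, (h.semiconj.iterate_right n) (logChart u x),
    expChart_logChart h.exponent_ne_zero hx]

theorem scaleBy_fixed (h : IsAveraging C u W) {p : K ⊕ K → ℝ} (hp : p ∈ posOrthant (K ⊕ K))
    (hfix : powerMap C u W p = p) {c : ℝ} (hc : 0 < c) :
    powerMap C u W (scaleBy c u p) = scaleBy c u p := by
  rw [h.scalesWithExponent p hp c hc, hfix]

theorem fixed_iff (h : IsAveraging C u W)
    (hconn : ∀ r k, Relation.TransGen (DependsOnVar C W) r k)
    (hloop : ∃ r, DependsOnVar C W r r) {p : K ⊕ K → ℝ} (hp : p ∈ posOrthant (K ⊕ K))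
    (hfix : powerMap C u W p = p) {x : K ⊕ K → ℝ} (hx : x ∈ posOrthant (K ⊕ K)) :
    powerMap C u W x = x ↔ ∃ c : ℝ, 0 < c ∧ x = scaleBy c u p := by
  constructor
  · intro hxfix
    -- A fixed point is the limit of its own constant orbit.
    obtain ⟨c, hc, hlim⟩ := h.exists_tendsto_iterate hconn hloop hp hfix hx
    refine ⟨c, hc, tendsto_nhds_unique (tendsto_const_nhds.congr fun n => ?_) hlim⟩
    exact (Function.iterate_fixed hxfix n).symm
  · rintro ⟨c, hc, rfl⟩
    exact h.scaleBy_fixed hp hfix hc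

end IsAveraging

end

noncomputable section

namespace Economy

variable {J : ℕ} (M : Economy J)

/-! ### The equilibrium system as a power map -/

/-- The coefficients of the equilibrium system. -/
def coeff : Fin J ⊕ Fin J → Fin J → ℝ
  | Sum.inl i, j => M.gammaConst ^ (-(M.θ / (1 - M.σ))) * M.A i * M.tradeFactor i j *
      (M.γ j / M.L j) ^ (-(M.θ * M.γ j / (1 + M.θ * M.γ j)))
  | Sum.inr i, j => M.gammaConst ^ (-(M.θ / (1 - M.σ))) * M.A j * M.tradeFactor j i *
      (M.γ j / M.L j) ^ (-(M.θ * M.γ j / (1 + M.θ * M.γ j)))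

/-- The weights of the variables in the logarithmic form of the equilibrium system. -/
def weight : Fin J ⊕ Fin J → Fin J ⊕ Fin J → ℝ
  | Sum.inl _, Sum.inl j => 1 / (1 + M.θ * M.γ j)
  | Sum.inl _, Sum.inr j => M.θ * M.γ j / (1 + M.θ * M.γ j)
  | Sum.inr _, Sum.inl j => (1 + M.θ) * M.γ j / (1 + M.θ * M.γ j)
  | Sum.inr _, Sum.inr j => (1 - M.γ j) / (1 + M.θ * M.γ j)

theorem θ_pos : 0 < M.θ := by linarith [M.one_lt_σ, M.σ_sub_one_lt_θ]

theorem one_add_pos (j : Fin J) : 0 < 1 + M.θ * M.γ j := by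
  have := mul_nonneg M.θ_pos.le (M.γ_nonneg j)
  linarith

theorem gammaConst_pos : 0 < M.gammaConst :=
  Real.Gamma_pos_of_pos (div_pos (by linarith [M.σ_sub_one_lt_θ]) M.θ_pos)

theorem tradeFactor_nonneg (i j : Fin J) : 0 ≤ M.tradeFactor i j := ENNReal.toReal_nonneg

theorem tradeFactor_pos {i j : Fin J} (h : M.τ i j ≠ ⊤) : 0 < M.tradeFactor i j := by
  have h0 : M.τ i j ≠ 0 := (zero_lt_one.trans_le (M.one_le_τ i j)).ne'
  refine ENNReal.toReal_pos ?_ ?_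
  · simp [ENNReal.rpow_eq_zero_iff, h, h0]
  · simp [ENNReal.rpow_eq_top_iff, h, h0]

/-- `(γ_j / L_j) ^ γ_j` is positive, also if `γ_j = 0`. -/
theorem laborFactor_pos (j : Fin J) : 0 < (M.γ j / M.L j) ^ M.γ j := by
  rcases (M.γ_nonneg j).eq_or_lt with h | h
  · simp [← h]
  · exact Real.rpow_pos_of_pos (div_pos h (M.L_pos j)) _

/-- For `γ_j = 0` the base on the left is 0. The base on the right is always positive, so the rules
for logarithms apply to it. -/
theorem laborFactor_rpow (j : Fin J) :
    (M.γ j / M.L j) ^ (-(M.θ * M.γ j / (1 + M.θ * M.γ j))) =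
      ((M.γ j / M.L j) ^ M.γ j) ^ (-(M.θ / (1 + M.θ * M.γ j))) := by
  rw [← Real.rpow_mul (div_nonneg (M.γ_nonneg j) (M.L_pos j).le)]
  ring_nf

theorem coeff_eq_mul_tradeFactor (i j : Fin J) :
    (∃ t > 0, M.coeff (Sum.inl i) j = t * M.tradeFactor i j) ∧
      ∃ t > 0, M.coeff (Sum.inr i) j = t * M.tradeFactor j i := by
  have hg := Real.rpow_pos_of_pos M.gammaConst_pos (-(M.θ / (1 - M.σ)))
  have hl := Real.rpow_pos_of_pos (M.laborFactor_pos j) (-(M.θ / (1 + M.θ * M.γ j)))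
  rw [← laborFactor_rpow] at hl
  exact ⟨⟨_, mul_pos (mul_pos hg (M.A_pos i)) hl, by simp only [coeff]; ring⟩,
    ⟨_, mul_pos (mul_pos hg (M.A_pos j)) hl, by simp only [coeff]; ring⟩⟩

theorem coeff_inl_pos {i j : Fin J} (h : M.τ i j ≠ ⊤) : 0 < M.coeff (Sum.inl i) j := by
  obtain ⟨t, ht, heq⟩ := (M.coeff_eq_mul_tradeFactor i j).1
  rw [heq]
  exact mul_pos ht (M.tradeFactor_pos h)

theorem coeff_inr_pos {i j : Fin J} (h : M.τ j i ≠ ⊤) : 0 < M.coeff (Sum.inr i) j := by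
  obtain ⟨t, ht, heq⟩ := (M.coeff_eq_mul_tradeFactor i j).2
  rw [heq]
  exact mul_pos ht (M.tradeFactor_pos h)

theorem exponent_eq (k : ℝ) : M.exponent k = fun j => k * M.exponent 1 j := by
  funext j
  rcases j with j | j
  · simp only [exponent, Sum.elim_inl]; ring
  · simp only [exponent, Sum.elim_inr]; ring

theorem exponent_one_ne_zero (r : Fin J ⊕ Fin J) : M.exponent 1 r ≠ 0 := by
  have := M.θ_pos
  rcases r with i | i
  · simp only [exponent, Sum.elim_inl]
    exact mul_ne_zero (neg_ne_zero.2 (by positivity)) one_ne_zero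
  · simp [exponent]

theorem isAveraging : IsAveraging M.coeff (M.exponent 1) M.weight where
  coeff_nonneg r j := by
    rcases r with i | i
    · obtain ⟨t, ht, heq⟩ := (M.coeff_eq_mul_tradeFactor i j).1
      rw [heq]
      exact mul_nonneg ht.le (M.tradeFactor_nonneg i j)
    · obtain ⟨t, ht, heq⟩ := (M.coeff_eq_mul_tradeFactor i j).2
      rw [heq]
      exact mul_nonneg ht.le (M.tradeFactor_nonneg j i)
  exists_coeff_pos r := by
    rcases r with i | i
    · exact ⟨i, M.coeff_inl_pos (M.τ_self_ne_top i)⟩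
    · exact ⟨i, M.coeff_inr_pos (M.τ_self_ne_top i)⟩
  exponent_ne_zero := M.exponent_one_ne_zero
  weight_nonneg r k := by
    have hθ := M.θ_pos
    rcases r with i | i <;> rcases k with j | j <;>
      refine div_nonneg ?_ (M.one_add_pos j).le
    · exact zero_le_one
    · exact mul_nonneg hθ.le (M.γ_nonneg j)
    · exact mul_nonneg (by linarith) (M.γ_nonneg j)
    · linarith [M.γ_le_one j]
  weight_add r j := by
    have := (M.one_add_pos j).ne'
    rcases r with i | i <;> simp only [weight] <;> field_simp
    ring

/-- The ratio `u_Ω / u_ℙ = -(1 + θ) / θ` turns the negative cross exponents of both blocks into the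
nonnegative weights that complement the diagonal ones to 1. -/
theorem rhs_eq_powerMap : M.rhs = powerMap M.coeff (M.exponent 1) M.weight := by
  funext x r
  have hθ := M.θ_pos
  have hu : -((1 + M.θ) / M.θ) * 1 ≠ 0 :=
    mul_ne_zero (neg_ne_zero.2 (by positivity)) one_ne_zero
  rcases r with i | i
  · simp only [rhs, powerMap, Sum.elim_inl]
    refine Finset.sum_congr rfl fun j _ => ?_
    have h1 := (M.one_add_pos j).ne'
    simp only [coeff, weight, exponent, Sum.elim_inl, Sum.elim_inr]
    congr 2
    · rw [mul_div_cancel_left₀ _ hu]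
    · rw [div_sub_one h1]
      field_simp
      ring
  · simp only [rhs, powerMap, Sum.elim_inr]
    refine Finset.sum_congr rfl fun j _ => ?_
    have h1 := (M.one_add_pos j).ne'
    simp only [coeff, weight, exponent, Sum.elim_inl, Sum.elim_inr]
    congr 2
    · congr 1
      field_simp
      ring
    · ring

/-! ### Connectivity of the equilibrium system -/

theorem dependsOnVar_inl_inl {i j : Fin J} (h : M.τ i j ≠ ⊤) :
    DependsOnVar M.coeff M.weight (Sum.inl i) (Sum.inl j) :=
  ⟨M.coeff_inl_pos h, div_pos one_pos (M.one_add_pos j)⟩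

theorem dependsOnVar_inl_inr {i j : Fin J} (h : M.τ i j ≠ ⊤) (hj : 0 < M.γ j) :
    DependsOnVar M.coeff M.weight (Sum.inl i) (Sum.inr j) :=
  ⟨M.coeff_inl_pos h, div_pos (mul_pos M.θ_pos hj) (M.one_add_pos j)⟩

theorem dependsOnVar_inr_inl {i j : Fin J} (h : M.τ j i ≠ ⊤) (hj : 0 < M.γ j) :
    DependsOnVar M.coeff M.weight (Sum.inr i) (Sum.inl j) :=
  ⟨M.coeff_inr_pos h, div_pos (mul_pos (by linarith [M.θ_pos]) hj) (M.one_add_pos j)⟩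

theorem dependsOnVar_inr_inr {i j : Fin J} (h : M.τ j i ≠ ⊤) (hj : M.γ j < 1) :
    DependsOnVar M.coeff M.weight (Sum.inr i) (Sum.inr j) :=
  ⟨M.coeff_inr_pos h, div_pos (by linarith) (M.one_add_pos j)⟩

variable {M}

/-- Follow a trade path from a labor-using country backwards from `i`. A supplier with `γ = 0` links
`ℙ` to `ℙ`; the first one with `γ > 0` gives a link to `Ω`. -/
theorem exists_reach_inl (hconn : M.StronglyConnected) (hlabor : ∃ i, 0 < M.γ i)
    (r : Fin J ⊕ Fin J) :
    ∃ m, Relation.ReflTransGen (DependsOnVar M.coeff M.weight) r (Sum.inl m) := by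
  rcases r with i | i
  · exact ⟨i, .refl⟩
  obtain ⟨l, hl⟩ := hlabor
  induction hconn l i with
  | refl => exact ⟨l, .single (M.dependsOnVar_inr_inl (M.τ_self_ne_top l) hl)⟩
  | @tail a b _ hab ih =>
    rcases (M.γ_nonneg a).eq_or_lt with ha | ha
    · obtain ⟨m, hm⟩ := ih
      exact ⟨m, .head (M.dependsOnVar_inr_inr hab (by linarith)) hm⟩
    · exact ⟨a, .single (M.dependsOnVar_inr_inl hab ha)⟩

/-- The mirror argument, along a trade path forwards from `i` to a labor-using country. -/
theorem exists_inl_reach (hconn : M.StronglyConnected) (hlabor : ∃ i, 0 < M.γ i)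
    (r : Fin J ⊕ Fin J) :
    ∃ m, Relation.ReflTransGen (DependsOnVar M.coeff M.weight) (Sum.inl m) r := by
  rcases r with i | i
  · exact ⟨i, .refl⟩
  obtain ⟨l, hl⟩ := hlabor
  induction hconn i l using Relation.ReflTransGen.head_induction_on with
  | refl => exact ⟨l, .single (M.dependsOnVar_inl_inr (M.τ_self_ne_top l) hl)⟩
  | @head a b hab _ ih =>
    rcases (M.γ_nonneg a).eq_or_lt with ha | ha
    · obtain ⟨m, hm⟩ := ih
      exact ⟨m, hm.tail (M.dependsOnVar_inr_inr hab (by linarith))⟩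
    · exact ⟨a, .single (M.dependsOnVar_inl_inr (M.τ_self_ne_top a) ha)⟩

theorem transGen_dependsOnVar (hconn : M.StronglyConnected) (hlabor : ∃ i, 0 < M.γ i)
    (r k : Fin J ⊕ Fin J) : Relation.TransGen (DependsOnVar M.coeff M.weight) r k := by
  obtain ⟨a, ha⟩ := exists_reach_inl hconn hlabor r
  obtain ⟨b, hb⟩ := exists_inl_reach hconn hlabor k
  have hab : Relation.ReflTransGen (DependsOnVar M.coeff M.weight) (Sum.inl a) (Sum.inl b) :=
    (hconn a b).lift Sum.inl fun i j hij => M.dependsOnVar_inl_inl hij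
  -- The `Ω`-block is strongly connected for all labor shares; the self-link at `a` makes the path
  -- nonempty even if `r = k`.
  exact Relation.TransGen.trans_right ha (Relation.TransGen.head'
    (M.dependsOnVar_inl_inl (M.τ_self_ne_top a)) (hab.trans hb))

theorem exists_dependsOnVar_self (hlabor : ∃ i, 0 < M.γ i) :
    ∃ r, DependsOnVar M.coeff M.weight r r := by
  obtain ⟨l, -⟩ := hlabor
  exact ⟨Sum.inl l, M.dependsOnVar_inl_inl (M.τ_self_ne_top l)⟩

/-! ### Equilibria -/

variable (M)

/-- The revenue of country `j` in terms of its multilateral resistance terms. -/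
def revenue (x : Fin J ⊕ Fin J → ℝ) (j : Fin J) : ℝ :=
  (M.γ j / M.L j) ^ (-(M.θ * M.γ j / (1 + M.θ * M.γ j))) *
    x (Sum.inl j) ^ (1 / (1 + M.θ * M.γ j)) * x (Sum.inr j) ^ ((1 - M.γ j) / (1 + M.θ * M.γ j))

theorem revenue_pos {x : Fin J ⊕ Fin J → ℝ} (hx : x ∈ posOrthant (Fin J ⊕ Fin J)) (j : Fin J) :
    0 < M.revenue x j := by
  rw [revenue, laborFactor_rpow]
  exact mul_pos (mul_pos (Real.rpow_pos_of_pos (M.laborFactor_pos j) _)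
    (Real.rpow_pos_of_pos (hx _) _)) (Real.rpow_pos_of_pos (hx _) _)

theorem rhs_inl {x : Fin J ⊕ Fin J → ℝ} (hx : x ∈ posOrthant (Fin J ⊕ Fin J)) (i : Fin J) :
    M.rhs x (Sum.inl i) = ∑ j, M.gammaConst ^ (-(M.θ / (1 - M.σ))) * M.A i * M.tradeFactor i j *
      (M.revenue x j / x (Sum.inr j)) := by
  simp only [rhs, Sum.elim_inl]
  refine Finset.sum_congr rfl fun j _ => ?_
  rw [Real.rpow_sub_one (hx _).ne', revenue]
  ring

theorem rhs_inr {x : Fin J ⊕ Fin J → ℝ} (hx : x ∈ posOrthant (Fin J ⊕ Fin J)) (i : Fin J) :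
    M.rhs x (Sum.inr i) = ∑ j, M.gammaConst ^ (-(M.θ / (1 - M.σ))) * M.A j * M.tradeFactor j i *
      (M.revenue x j / x (Sum.inl j)) := by
  simp only [rhs, Sum.elim_inr]
  refine Finset.sum_congr rfl fun j _ => ?_
  rw [Real.rpow_sub_one (hx _).ne', revenue]
  ring

theorem unitCost_eq {R P : ℝ} (hR : 0 < R) (j : Fin J) :
    (M.γ j * R / M.L j) ^ M.γ j * P ^ (1 - M.γ j) =
      (M.γ j / M.L j) ^ M.γ j * R ^ M.γ j * P ^ (1 - M.γ j) := by
  rw [← Real.mul_rpow (div_nonneg (M.γ_nonneg j) (M.L_pos j).le) hR.le]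
  ring_nf

theorem unitCost_pos {R P : ℝ} (hR : 0 < R) (hP : 0 < P) (j : Fin J) :
    0 < (M.γ j * R / M.L j) ^ M.γ j * P ^ (1 - M.γ j) := by
  rw [M.unitCost_eq hR]
  exact mul_pos (mul_pos (M.laborFactor_pos j) (Real.rpow_pos_of_pos hR _))
    (Real.rpow_pos_of_pos hP _)

/-- With wage and unit cost substituted, `Ω = R c ^ θ` is linear in `log R` with slope `1 + θ γ_j >
0`, hence uniquely solvable. -/
theorem revenue_eq_iff {x : Fin J ⊕ Fin J → ℝ} (hx : x ∈ posOrthant (Fin J ⊕ Fin J)) {R P : ℝ}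
    (hR : 0 < R) (hP : 0 < P) {j : Fin J} (hxP : x (Sum.inr j) = P ^ (-M.θ)) :
    M.revenue x j = R ↔
      x (Sum.inl j) = R * ((M.γ j * R / M.L j) ^ M.γ j * P ^ (1 - M.γ j)) ^ M.θ := by
  have hκ := M.laborFactor_pos j
  have hΩ := hx (Sum.inl j)
  have hc := M.unitCost_pos hR hP j
  have h1 := M.one_add_pos j
  have hlogR : Real.log (M.revenue x j) * (1 + M.θ * M.γ j) =
      -M.θ * Real.log ((M.γ j / M.L j) ^ M.γ j) + Real.log (x (Sum.inl j)) -
        (1 - M.γ j) * M.θ * Real.log P := by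
    rw [revenue, laborFactor_rpow, hxP, Real.log_mul, Real.log_mul, Real.log_rpow hκ,
      Real.log_rpow hΩ, Real.log_rpow (Real.rpow_pos_of_pos hP _), Real.log_rpow hP]
    · field_simp
      ring
    all_goals positivity
  have hlogΩ : Real.log (R * ((M.γ j * R / M.L j) ^ M.γ j * P ^ (1 - M.γ j)) ^ M.θ) =
      Real.log R + M.θ * (Real.log ((M.γ j / M.L j) ^ M.γ j) + M.γ j * Real.log R +
        (1 - M.γ j) * Real.log P) := by
    rw [Real.log_mul hR.ne' (Real.rpow_pos_of_pos hc _).ne', Real.log_rpow hc, M.unitCost_eq hR,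
      Real.log_mul, Real.log_mul, Real.log_rpow hR, Real.log_rpow hP]
    all_goals positivity
  rw [← Real.log_injOn_pos.eq_iff (M.revenue_pos hx j) hR,
    ← Real.log_injOn_pos.eq_iff hΩ (mul_pos hR (Real.rpow_pos_of_pos hc _)), hlogΩ,
    ← mul_left_inj' h1.ne', hlogR]
  constructor <;> intro h <;> linarith

theorem resistance_mem {c P R : Fin J → ℝ} (hc : ∀ i, 0 < c i) (hP : ∀ i, 0 < P i)
    (hR : ∀ i, 0 < R i) : M.resistance c P R ∈ posOrthant (Fin J ⊕ Fin J) := by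
  rintro (i | i)
  · exact mul_pos (hR i) (Real.rpow_pos_of_pos (hc i) _)
  · exact Real.rpow_pos_of_pos (hP i) _

theorem price_index_iff {P D : ℝ} (hP : 0 < P) (hD : 0 < D) :
    P = M.gammaConst ^ (1 / (1 - M.σ)) * D ^ (-(1 / M.θ)) ↔
      M.gammaConst ^ (-(M.θ / (1 - M.σ))) * D = P ^ (-M.θ) := by
  have hθ := M.θ_pos
  have hg := M.gammaConst_pos
  have h1 : 0 < M.gammaConst ^ (1 / (1 - M.σ)) := Real.rpow_pos_of_pos hg _
  have h2 : 0 < D ^ (-(1 / M.θ)) := Real.rpow_pos_of_pos hD _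
  have h3 : 0 < M.gammaConst ^ (-(M.θ / (1 - M.σ))) := Real.rpow_pos_of_pos hg _
  have h4 : 0 < P ^ (-M.θ) := Real.rpow_pos_of_pos hP _
  rw [← Real.log_injOn_pos.eq_iff hP (mul_pos h1 h2),
    ← Real.log_injOn_pos.eq_iff (mul_pos h3 hD) h4, Real.log_mul h1.ne' h2.ne',
    Real.log_mul h3.ne' hD.ne', Real.log_rpow hg, Real.log_rpow hD, Real.log_rpow hg,
    Real.log_rpow hP]
  have hne : -M.θ ≠ 0 := neg_ne_zero.2 hθ.ne'
  rw [← mul_right_inj' hne]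
  have h5 : -M.θ * (1 / (1 - M.σ) * Real.log M.gammaConst + -(1 / M.θ) * Real.log D) =
      -(M.θ / (1 - M.σ)) * Real.log M.gammaConst + Real.log D := by
    field_simp
    ring
  rw [h5, eq_comm]

/-- If the definitions of wages, unit costs and expenditures hold, the remaining equilibrium
conditions say that the multilateral resistance terms solve the equilibrium system. -/
theorem isEquilibrium_iff {w c P R E : Fin J → ℝ} (hP : ∀ i, 0 < P i) (hR : ∀ i, 0 < R i)
    (hc : ∀ i, c i = w i ^ M.γ i * P i ^ (1 - M.γ i)) (hw : ∀ i, w i = M.γ i * R i / M.L i)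
    (hE : ∀ i, E i = w i * M.L i + (1 - M.γ i) * R i) :
    M.IsEquilibrium w c P R E ↔ M.rhs (M.resistance c P R) = M.resistance c P R := by
  have hc_pos : ∀ i, 0 < c i := fun i => by
    rw [hc, hw]
    exact M.unitCost_pos (hR i) (hP i) i
  have hx := M.resistance_mem hc_pos hP hR
  have hrev : ∀ j, M.revenue (M.resistance c P R) j = R j := fun j => by
    rw [M.revenue_eq_iff hx (hR j) (hP j) rfl, ← hw, ← hc]
    rfl
  -- The wage bill is `γ_j R_j`, so expenditure equals revenue.
  have hER : ∀ j, E j = R j := fun j => by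
    have := (M.L_pos j).ne'
    rw [hE, hw]
    field_simp
    ring
  have hD : ∀ i, 0 < ∑ j, M.A j * (c j ^ (-M.θ) * M.tradeFactor j i) := fun i =>
    Finset.sum_pos' (fun j _ => mul_nonneg (M.A_pos j).le
        (mul_nonneg (Real.rpow_nonneg (hc_pos j).le _) (M.tradeFactor_nonneg j i)))
      ⟨i, Finset.mem_univ i, mul_pos (M.A_pos i)
        (mul_pos (Real.rpow_pos_of_pos (hc_pos i) _) (M.tradeFactor_pos (M.τ_self_ne_top i)))⟩
  have hprice : ∀ i, (P i = M.gammaConst ^ (1 / (1 - M.σ)) *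
      (∑ j, M.A j * (c j ^ (-M.θ) * M.tradeFactor j i)) ^ (-(1 / M.θ))) ↔
      M.rhs (M.resistance c P R) (Sum.inr i) = M.resistance c P R (Sum.inr i) := fun i => by
    rw [M.price_index_iff (hP i) (hD i), M.rhs_inr hx, Finset.mul_sum]
    refine Eq.congr (Finset.sum_congr rfl fun j _ => ?_) rfl
    have h1 := (hR j).ne'
    have h2 := (Real.rpow_pos_of_pos (hc_pos j) M.θ).ne'
    rw [hrev, Real.rpow_neg (hc_pos j).le]
    simp only [resistance, Sum.elim_inl]
    field_simp
  -- The denominators of the trade shares are multiples of `P j ^ (-θ)` only under the price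
  -- equations, so the `ℙ`-rows are assumed here.
  have hgoods : (∀ i, M.rhs (M.resistance c P R) (Sum.inr i) = M.resistance c P R (Sum.inr i)) →
      ∀ i, (R i = ∑ j, (M.A i * (c i ^ (-M.θ) * M.tradeFactor i j) /
        ∑ l, M.A l * (c l ^ (-M.θ) * M.tradeFactor l j)) * E j) ↔
      M.rhs (M.resistance c P R) (Sum.inl i) = M.resistance c P R (Sum.inl i) := fun hin i => by
    have hDP : ∀ j, M.gammaConst ^ (-(M.θ / (1 - M.σ))) *
        ∑ l, M.A l * (c l ^ (-M.θ) * M.tradeFactor l j) = P j ^ (-M.θ) := fun j =>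
      (M.price_index_iff (hP j) (hD j)).1 ((hprice j).2 (hin j))
    have hcθ := Real.rpow_pos_of_pos (hc_pos i) M.θ
    have hsum : M.rhs (M.resistance c P R) (Sum.inl i) = (∑ j,
        (M.A i * (c i ^ (-M.θ) * M.tradeFactor i j) /
          ∑ l, M.A l * (c l ^ (-M.θ) * M.tradeFactor l j)) * E j) * c i ^ M.θ := by
      rw [M.rhs_inl hx, Finset.sum_mul]
      refine Finset.sum_congr rfl fun j _ => ?_
      have h1 := (Real.rpow_pos_of_pos M.gammaConst_pos (-(M.θ / (1 - M.σ)))).ne'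
      have h2 := (hD j).ne'
      rw [hrev, hER, show M.resistance c P R (Sum.inr j) = P j ^ (-M.θ) from rfl, ← hDP j,
        Real.rpow_neg (hc_pos i).le]
      field_simp
    rw [hsum, show M.resistance c P R (Sum.inl i) = R i * c i ^ M.θ from rfl,
      mul_left_inj' hcθ.ne', eq_comm]
  constructor
  · intro h
    have hin := fun i => (hprice i).1 (h.price_index i)
    funext r
    rcases r with i | i
    · exact (hgoods hin i).1 (h.goods_market i)
    · exact hin i
  · intro h
    have hin := fun i => congrFun h (Sum.inr i)
    exact ⟨hP, hR, hc, fun i => (hprice i).2 (hin i),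
      fun i => (hgoods hin i).2 (congrFun h (Sum.inl i)), hw, hE⟩

/-- From a solution, `P = ℙ ^ (-1/θ)` and `R = revenue` determine the other quantities by their
defining equations. -/
theorem rhs_eq_self_iff {x : Fin J ⊕ Fin J → ℝ} (hx : x ∈ posOrthant (Fin J ⊕ Fin J)) :
    M.rhs x = x ↔ ∃ w c P R E, M.IsEquilibrium w c P R E ∧ x = M.resistance c P R := by
  constructor
  · intro hfix
    have hP : ∀ i, 0 < x (Sum.inr i) ^ (-(1 / M.θ)) := fun i => Real.rpow_pos_of_pos (hx _) _
    have hxP : ∀ i, x (Sum.inr i) = (x (Sum.inr i) ^ (-(1 / M.θ))) ^ (-M.θ) := fun i => by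
      rw [← Real.rpow_mul (hx _).le, neg_mul_neg, one_div_mul_cancel M.θ_pos.ne', Real.rpow_one]
    let P : Fin J → ℝ := fun i => x (Sum.inr i) ^ (-(1 / M.θ))
    let w : Fin J → ℝ := fun i => M.γ i * M.revenue x i / M.L i
    let c : Fin J → ℝ := fun i => w i ^ M.γ i * P i ^ (1 - M.γ i)
    have hres : x = M.resistance c P (M.revenue x) := by
      funext r
      rcases r with i | i
      · exact (M.revenue_eq_iff hx (M.revenue_pos hx i) (hP i) (hxP i)).1 rfl
      · exact hxP i
    refine ⟨w, c, P, M.revenue x, fun i => w i * M.L i + (1 - M.γ i) * M.revenue x i, ?_, hres⟩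
    rw [M.isEquilibrium_iff hP (M.revenue_pos hx) (fun _ => rfl) (fun _ => rfl) fun _ => rfl,
      ← hres]
    exact hfix
  · rintro ⟨w, c, P, R, E, h, rfl⟩
    exact (M.isEquilibrium_iff h.P_pos h.R_pos h.unit_cost h.labor_market h.balanced_trade).1 h

end Economy

end

theorem mainTheorem2 {J : ℕ} (M : Economy J) (hconn : M.StronglyConnected)
    (hlabor : ∃ i, 0 < M.γ i) :
    -- the positive solutions of the system are the resistance terms of the equilibria
    (∀ x ∈ posOrthant (Fin J ⊕ Fin J),
      M.rhs x = x ↔ ∃ w c P R E, M.IsEquilibrium w c P R E ∧ x = M.resistance c P R) ∧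
    -- the system satisfies all hypotheses on the right-hand side, for every `k ≠ 0`
    Set.MapsTo M.rhs (posOrthant (Fin J ⊕ Fin J)) (posOrthant (Fin J ⊕ Fin J)) ∧
    ContDiffOn ℝ 1 M.rhs (posOrthant (Fin J ⊕ Fin J)) ∧
    ConnectsAllVariables M.rhs ∧
    ExhibitsSelfInteraction M.rhs ∧
    (∀ k : ℝ, k ≠ 0 →
      (∃ j, M.exponent k j ≠ 0) ∧
      ScalesWithExponent M.rhs (M.exponent k) ∧
      MonotonicityConsistent M.rhs (M.exponent k)) ∧
    -- any solution is unique up to scale, stable, and attractive under iteration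
    (∀ p ∈ posOrthant (Fin J ⊕ Fin J), M.rhs p = p →
      (∀ k : ℝ, k ≠ 0 → ∀ x ∈ posOrthant (Fin J ⊕ Fin J),
        M.rhs x = x ↔ ∃ c : ℝ, 0 < c ∧ x = scaleBy c (M.exponent k) p) ∧
      LyapunovStable M.rhs p ∧
      (∀ x ∈ posOrthant (Fin J ⊕ Fin J), ∃ q ∈ posOrthant (Fin J ⊕ Fin J),
        M.rhs q = q ∧
        Filter.Tendsto (fun n : ℕ => M.rhs^[n] x) Filter.atTop (nhds q))) := by

  have hav := M.isAveraging
  have htrans := Economy.transGen_dependsOnVar hconn hlabor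
  have hloop := Economy.exists_dependsOnVar_self hlabor
  refine ⟨fun x hx => M.rhs_eq_self_iff hx, ?_⟩
  rw [M.rhs_eq_powerMap]
  refine ⟨hav.mapsTo, IsAveraging.contDiffOn _ _ _, hav.connectsAllVariables htrans,
    hav.exhibitsSelfInteraction hloop, fun k hk => ?_, fun p hp hfix => ⟨fun k hk x hx => ?_,
      hav.lyapunovStable hp hfix, fun x hx => ?_⟩⟩
  · rw [M.exponent_eq k]
    obtain ⟨l, -⟩ := hlabor
    refine ⟨⟨Sum.inl l, mul_ne_zero hk (M.exponent_one_ne_zero _)⟩, fun x hx c hc => ?_,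
      hav.monotonicityConsistent hk⟩
    rw [scaleBy_const_mul hc, scaleBy_const_mul hc]
    exact hav.scalesWithExponent x hx _ (Real.rpow_pos_of_pos hc k)
  · rw [hav.fixed_iff htrans hloop hp hfix hx, M.exponent_eq k]
    constructor
    · rintro ⟨c, hc, rfl⟩
      -- Since `u(k) = k * u(1)`, the factor `c` for `u(1)` corresponds to `c ^ (1/k)` for `u(k)`.
      have hc' := Real.rpow_pos_of_pos hc k⁻¹
      refine ⟨c ^ k⁻¹, hc', ?_⟩
      rw [scaleBy_const_mul hc', Real.rpow_inv_rpow hc.le hk]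
    · rintro ⟨c, hc, rfl⟩
      exact ⟨c ^ k, Real.rpow_pos_of_pos hc k, scaleBy_const_mul hc k _ _⟩
  · obtain ⟨c, hc, hlim⟩ := hav.exists_tendsto_iterate htrans hloop hp hfix hx
    exact ⟨_, scaleBy_mem hc _ hp, hav.scaleBy_fixed hp hfix hc, hlim⟩
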